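/- Let $d\ge 1$, let $B\subset\mathbb R^d$ be an open ball of positive radius, and let $X=C(\overline B)$ be the space of real-valued continuous functions on $\overline B$ with the supremum norm. Let $\Omega\subset B$ be an open set (hence bounded) which is Dirichlet regular, i.e. for every $g\in C(\partial\Omega)$ there is $u\in C^2(\Omega)\cap C(\overline\Omega)$ with $\Delta u=0$ in $\Omega$ and $u|_{\partial\Omega}=g$. Define the Dirichlet Laplacian of $\Omega$ as the linear relation (linear subspace of $X\times X$) $$A_\Omega=\Big\{(u,f)\in X\times X:\ u=0 \text{ on } \overline B\setminus\Omega,\ \int_B u\,\Delta\varphi\,dx=\int_B f\varphi\,dx \text{ for all } \varphi\in C_c^\infty(\Omega)\Big\}.$$ Then: 1. $A_\Omega$ is $m$-dissipative, that is, $\|\lambda u\|_\infty\le\|\lambda u-f\|_\infty$ for all $(u,f)\in A_\Omega$ and all $\lambda>0$, and there is $\lambda>0$ with $\operatorname{ran}(\lambda-A_\Omega)=X$, where $\lambda-A_\Omega=\{(u,\lambda u-f):(u,f)\in A_\Omega\}$ and the range of a relation $R\subset X\times X$ is $\operatorname{ran}R=\{y:\exists x,\ (x,y)\in R\}$. 2.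 $0\in\rho(A_\Omega)$. Here $\lambda\in\mathbb R$ belongs to the resolvent set $\rho(A_\Omega)$ if the relation $\lambda-A_\Omega$ is closed in $X\times X$, has trivial kernel $\{x:(x,0)\in\lambda-A_\Omega\}=\{0\}$, and satisfies $\operatorname{ran}(\lambda-A_\Omega)=X$. -/

import Mathlib

open scoped Distributions

/-- A (linear) relation in `X`: a linear subspace of `X × X`. -/
abbrev LinearRelation (X : Type*) [NormedAddCommGroup X] [NormedSpace ℝ X] : Type _ :=
  Submodule ℝ (X × X)

namespace LinearRelation

/-- The range `{y | ∃ x, (x, y) ∈ A}` of a relation. -/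
def ran {X : Type*} [NormedAddCommGroup X] [NormedSpace ℝ X] (A : LinearRelation X) :
    Submodule ℝ X :=
  Submodule.map (LinearMap.snd ℝ X X) A

/-- The kernel `{x | (x, 0) ∈ A}` of a relation. -/
def ker {X : Type*} [NormedAddCommGroup X] [NormedSpace ℝ X] (A : LinearRelation X) :
    Submodule ℝ X :=
  Submodule.comap (LinearMap.inl ℝ X X) A

/-- The relation `l - A = {(x, l x - y) | (x, y) ∈ A}`. -/
def scalarSub {X : Type*} [NormedAddCommGroup X] [NormedSpace ℝ X] (l : ℝ)
    (A : LinearRelation X) : LinearRelation X :=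
  Submodule.map
    ((LinearMap.fst ℝ X X).prod (l • LinearMap.fst ℝ X X - LinearMap.snd ℝ X X)) A

theorem mem_ran {X : Type*} [NormedAddCommGroup X] [NormedSpace ℝ X] {A : LinearRelation X}
    {y : X} : y ∈ A.ran ↔ ∃ x, (x, y) ∈ A := by
  simp [ran]

theorem mem_ker {X : Type*} [NormedAddCommGroup X] [NormedSpace ℝ X] {A : LinearRelation X}
    {x : X} : x ∈ A.ker ↔ (x, (0 : X)) ∈ A := by
  simp [ker]

theorem mem_scalarSub {X : Type*} [NormedAddCommGroup X] [NormedSpace ℝ X] {l : ℝ}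
    {A : LinearRelation X} {p : X × X} :
    p ∈ scalarSub l A ↔ ∃ x y, (x, y) ∈ A ∧ p = (x, l • x - y) := by
  simp [scalarSub, eq_comm]

/-- A relation is invertible if it is closed, has trivial kernel and is surjective. -/
def IsInvertible {X : Type*} [NormedAddCommGroup X] [NormedSpace ℝ X]
    (A : LinearRelation X) : Prop :=
  IsClosed (A : Set (X × X)) ∧ A.ker = ⊥ ∧ A.ran = ⊤

/-- The (real) resolvent set `ρ(A)`: those `l` for which `l - A` is invertible. -/
def resolventSet {X : Type*} [NormedAddCommGroup X] [NormedSpace ℝ X]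
    (A : LinearRelation X) : Set ℝ :=
  {l | (scalarSub l A).IsInvertible}

/-- `‖l x‖ ≤ ‖l x - y‖` for all `(x, y) ∈ A` and all `l > 0`. -/
def IsDissipative {X : Type*} [NormedAddCommGroup X] [NormedSpace ℝ X]
    (A : LinearRelation X) : Prop :=
  ∀ x y : X, (x, y) ∈ A → ∀ l : ℝ, 0 < l → ‖l • x‖ ≤ ‖l • x - y‖

/-- `A` is dissipative and `ran (l - A) = X` for some `l > 0`. -/
def IsMDissipative {X : Type*} [NormedAddCommGroup X] [NormedSpace ℝ X]
    (A : LinearRelation X) : Prop :=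
  A.IsDissipative ∧ ∃ l : ℝ, 0 < l ∧ (scalarSub l A).ran = ⊤

end LinearRelation

/-- An open set `Ω` is Dirichlet regular if every continuous function on its boundary is the
boundary value of some `u ∈ C²(Ω) ∩ C(closure Ω)` with `Δ u = 0` in `Ω`. -/
def DirichletRegular {d : ℕ} (Ω : TopologicalSpace.Opens (EuclideanSpace ℝ (Fin d))) : Prop :=
  ∀ g : C(frontier (Ω : Set (EuclideanSpace ℝ (Fin d))), ℝ),
    ∃ u : EuclideanSpace ℝ (Fin d) → ℝ,
      ContDiffOn ℝ 2 u Ω ∧ ContinuousOn u (closure (Ω : Set (EuclideanSpace ℝ (Fin d)))) ∧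
      (∀ x ∈ Ω, Laplacian.laplacian u x = 0) ∧
      ∀ x : frontier (Ω : Set (EuclideanSpace ℝ (Fin d))), u x = g x

/-- Lebesgue measure on the closed ball, as a measure on the subtype. -/
noncomputable def ballVolume {d : ℕ} (c : EuclideanSpace ℝ (Fin d)) (r : ℝ) :
    MeasureTheory.Measure (Metric.closedBall c r) :=
  MeasureTheory.Measure.comap Subtype.val MeasureTheory.volume

theorem integrable_mul_continuous {d : ℕ} {c : EuclideanSpace ℝ (Fin d)} {r : ℝ}
    (u : C(Metric.closedBall c r, ℝ)) {ψ : EuclideanSpace ℝ (Fin d) → ℝ} (hψ : Continuous ψ) :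
    MeasureTheory.Integrable (fun x : Metric.closedBall c r => u x * ψ x) (ballVolume c r) := by
  have hfin : MeasureTheory.IsFiniteMeasure (ballVolume c r) :=
    ⟨by
      rw [ballVolume, MeasureTheory.Measure.comap_apply _ Subtype.val_injective
        (fun s hs => (MeasurableEmbedding.subtype_coe
          Metric.isClosed_closedBall.measurableSet).measurableSet_image.2 hs) _ MeasurableSet.univ]
      rw [Set.image_univ, Subtype.range_coe]
      exact MeasureTheory.measure_closedBall_lt_top⟩
  have hc : Continuous (fun x : Metric.closedBall c r => u x * ψ x) :=
    u.continuous.mul (hψ.comp continuous_subtype_val)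
  exact hc.integrable_of_hasCompactSupport (HasCompactSupport.of_compactSpace _)

theorem continuous_laplacian_testFunction {d : ℕ}
    {Ω : TopologicalSpace.Opens (EuclideanSpace ℝ (Fin d))} (φ : 𝓓(Ω, ℝ)) :
    Continuous (Laplacian.laplacian (φ : EuclideanSpace ℝ (Fin d) → ℝ)) := by
  rw [InnerProductSpace.laplacian_eq_iteratedFDeriv_stdOrthonormalBasis]
  have h : Continuous (iteratedFDeriv ℝ 2 (φ : EuclideanSpace ℝ (Fin d) → ℝ)) :=
    φ.contDiff.continuous_iteratedFDeriv (WithTop.coe_le_coe.2 le_top)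
  refine continuous_finsetSum _ fun i _ => ?_
  exact (ContinuousEvalConst.continuous_eval_const _).comp h

/-- The Dirichlet Laplacian `A_Ω` as a relation in `C(closedBall c r)`: the pairs `(u, f)` such
that `u = 0` on `closedBall c r \ Ω` and `Δ u = f` in the sense of distributions on `Ω`, that is,
`∫ u Δφ = ∫ f φ` for all test functions `φ` on `Ω`. -/
noncomputable def dirichletLaplacian {d : ℕ} (c : EuclideanSpace ℝ (Fin d)) (r : ℝ)
    (Ω : TopologicalSpace.Opens (EuclideanSpace ℝ (Fin d))) :
    LinearRelation C(Metric.closedBall c r, ℝ) where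
  carrier := {p | (∀ x : Metric.closedBall c r, (x : EuclideanSpace ℝ (Fin d)) ∉ Ω → p.1 x = 0) ∧
    ∀ φ : 𝓓(Ω, ℝ),
      ∫ x : Metric.closedBall c r,
          p.1 x * Laplacian.laplacian (φ : EuclideanSpace ℝ (Fin d) → ℝ) x ∂(ballVolume c r) =
        ∫ x : Metric.closedBall c r, p.2 x * φ x ∂(ballVolume c r)}
  zero_mem' := by simp
  add_mem' := by
    rintro ⟨u, f⟩ ⟨v, g⟩ ⟨hu, huf⟩ ⟨hv, hvg⟩
    refine ⟨fun x hx => ?_, fun φ => ?_⟩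
    · have h1 := hu x hx
      have h2 := hv x hx
      simp_all
    · have hL := continuous_laplacian_testFunction φ
      simp only [Prod.mk_add_mk, ContinuousMap.add_apply, add_mul]
      rw [MeasureTheory.integral_add (integrable_mul_continuous u hL)
          (integrable_mul_continuous v hL),
        MeasureTheory.integral_add (integrable_mul_continuous f φ.continuous)
          (integrable_mul_continuous g φ.continuous)]
      exact congrArg₂ (· + ·) (huf φ) (hvg φ)
  smul_mem' := by
    rintro a ⟨u, f⟩ ⟨hu, huf⟩
    refine ⟨fun x hx => ?_, fun φ => ?_⟩
    · have h1 := hu x hx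
      simp_all
    · simp only [Prod.smul_mk, ContinuousMap.smul_apply, smul_eq_mul, mul_assoc]
      rw [MeasureTheory.integral_const_mul, MeasureTheory.integral_const_mul]
      exact congrArg (a * ·) (huf φ)

section Calculus

open MeasureTheory Module Metric

variable {E : Type*} [NormedAddCommGroup E] [InnerProductSpace ℝ E]

theorem ContDiffAt.fderiv_fderiv_apply {u : E → ℝ} {x : E} (hu : ContDiffAt ℝ 2 u x) (e : E) :
    fderiv ℝ (fun y => fderiv ℝ u y e) x e = fderiv ℝ (fderiv ℝ u) x e e := by
  have h : DifferentiableAt ℝ (fderiv ℝ u) x :=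
    (hu.fderiv_right (m := 1) (by norm_num)).differentiableAt one_ne_zero
  rw [fderiv_clm_apply h (differentiableAt_const _)]
  simp

theorem ContDiffOn.fderiv_apply_of_isOpen {u : E → ℝ} {s : Set E} {m n : WithTop ℕ∞}
    (hu : ContDiffOn ℝ n u s) (hs : IsOpen s) (hmn : m + 1 ≤ n) (e : E) :
    ContDiffOn ℝ m (fun y => fderiv ℝ u y e) s :=
  (hu.fderiv_of_isOpen hs hmn).clm_apply contDiffOn_const

theorem IsLocalMax.fderiv_fderiv_nonpos {F : E → ℝ} {x : E} (hmax : IsLocalMax F x)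
    (hF : ContDiffAt ℝ 2 F x) (e : E) : fderiv ℝ (fun y => fderiv ℝ F y e) x e ≤ 0 := by
  by_contra! hpos
  set g : ℝ → ℝ := fun t => F (x + t • e) with hg
  have hline (t : ℝ) : HasDerivAt (fun t : ℝ => x + t • e) e t := by
    simpa using ((hasDerivAt_id t).smul_const e).const_add x
  have htend : Filter.Tendsto (fun t : ℝ => x + t • e) (nhds 0) (nhds x) := by
    simpa using (hline 0).continuousAt.tendsto
  have hev : ∀ᶠ t : ℝ in nhds 0, deriv g t = fderiv ℝ F (x + t • e) e := by
    filter_upwards [htend.eventually (hF.eventually (by simp))] with t ht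
    exact ((ht.differentiableAt two_ne_zero).hasFDerivAt.comp_hasDerivAt t (hline t)).deriv
  have hF' : DifferentiableAt ℝ (fun y => fderiv ℝ F y e) (x + (0 : ℝ) • e) := by
    have h := (hF.fderiv_right (m := 1) (by norm_num)).differentiableAt one_ne_zero
    simpa using h.clm_apply (differentiableAt_const e)
  have hderiv2 : deriv (deriv g) 0 = fderiv ℝ (fun y => fderiv ℝ F y e) x e := by
    rw [Filter.EventuallyEq.deriv_eq hev]
    have := (hF'.hasFDerivAt.comp_hasDerivAt (0 : ℝ) (hline 0)).deriv
    simpa [Function.comp_def] using this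
  have hmaxg : IsLocalMax g 0 := by
    have := htend.eventually hmax
    simpa [IsLocalMax, IsMaxFilter, hg] using this
  have hcont : ContinuousAt g 0 := by
    have h1 : ContinuousAt F (x + (0 : ℝ) • e) := by simpa using hF.continuousAt
    exact h1.comp (f := fun t : ℝ => x + t • e) (hline 0).continuousAt
  have hmin : IsLocalMin g 0 :=
    isLocalMin_of_deriv_deriv_pos (hderiv2 ▸ hpos) hmaxg.deriv_eq_zero hcont
  have hconst : g =ᶠ[nhds 0] fun _ => g 0 := by
    filter_upwards [hmaxg, hmin] with t h1 h2 using le_antisymm h1 h2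
  have hzero : deriv (deriv g) 0 = 0 := by
    rw [Filter.EventuallyEq.deriv_eq hconst.deriv]
    simp
  rw [← hderiv2, hzero] at hpos
  exact lt_irrefl _ hpos

theorem fderiv_norm_sub_sq_apply (c y e : E) :
    fderiv ℝ (fun z => ‖z - c‖ ^ 2) y e = 2 * inner ℝ (y - c) e := by
  have h := ((hasFDerivAt_id (𝕜 := ℝ) y).sub_const c).norm_sq
  simp only [id] at h
  rw [h.fderiv]
  simp [inner_sub_left]

variable [FiniteDimensional ℝ E]

theorem ContDiffAt.laplacian_eq_sum {u : E → ℝ} {x : E} (hu : ContDiffAt ℝ 2 u x) :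
    Laplacian.laplacian u x = ∑ i, fderiv ℝ
      (fun y => fderiv ℝ u y (stdOrthonormalBasis ℝ E i)) x (stdOrthonormalBasis ℝ E i) := by
  rw [InnerProductSpace.laplacian_eq_iteratedFDeriv_stdOrthonormalBasis]
  simp [iteratedFDeriv_two_apply, hu.fderiv_fderiv_apply]

theorem ContDiffOn.continuousOn_laplacian {u : E → ℝ} {s : Set E} (hu : ContDiffOn ℝ 2 u s)
    (hs : IsOpen s) : ContinuousOn (Laplacian.laplacian u) s := by
  have h : ContinuousOn (fun x => ∑ i, fderiv ℝ
      (fun y => fderiv ℝ u y (stdOrthonormalBasis ℝ E i)) x (stdOrthonormalBasis ℝ E i)) s :=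
    continuousOn_finsetSum _ fun i _ =>
      (((hu.fderiv_apply_of_isOpen hs (m := 1) (by norm_num) _).fderiv_apply_of_isOpen hs
        (m := 0) (by norm_num) _).continuousOn)
  exact h.congr fun x hx => (hu.contDiffAt (hs.mem_nhds hx)).laplacian_eq_sum

theorem IsLocalMax.laplacian_nonpos {F : E → ℝ} {x : E} (hmax : IsLocalMax F x)
    (hF : ContDiffAt ℝ 2 F x) : Laplacian.laplacian F x ≤ 0 := by
  rw [hF.laplacian_eq_sum]
  exact Finset.sum_nonpos fun i _ => hmax.fderiv_fderiv_nonpos hF _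

theorem laplacian_const_sub_comp {ρ : E → ℝ} (hρ : ContDiff ℝ 2 ρ) (x t : E) :
    Laplacian.laplacian (fun y => ρ (x - y)) t = Laplacian.laplacian ρ (x - t) := by
  have key (σ : E → ℝ) (hσ : Differentiable ℝ σ) (s e : E) :
      fderiv ℝ (fun y => σ (x - y)) s e = -fderiv ℝ σ (x - s) e := by
    have h1 : HasFDerivAt (fun y : E => x - y) (-ContinuousLinearMap.id ℝ E) s :=
      (hasFDerivAt_id s).const_sub x
    have h2 := (hσ (x - s)).hasFDerivAt.comp s h1
    rw [show (fun y => σ (x - y)) = σ ∘ fun y => x - y from rfl, h2.fderiv]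
    simp
  have hd : ContDiff ℝ 2 (fun y => ρ (x - y)) := hρ.comp (contDiff_const.sub contDiff_id)
  rw [hd.contDiffAt.laplacian_eq_sum, hρ.contDiffAt.laplacian_eq_sum]
  refine Finset.sum_congr rfl fun i _ => ?_
  have h2 : Differentiable ℝ fun y => fderiv ℝ ρ y (stdOrthonormalBasis ℝ E i) :=
    ((hρ.fderiv_right (m := 1) (by norm_num)).clm_apply contDiff_const).differentiable one_ne_zero
  simp_rw [key ρ (hρ.differentiable two_ne_zero)]
  rw [fderiv_fun_neg, neg_apply, key _ h2, neg_neg]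

theorem laplacian_norm_sub_sq (c x : E) :
    Laplacian.laplacian (fun y : E => ‖y - c‖ ^ 2) x = 2 * finrank ℝ E := by
  have hd : ContDiff ℝ 2 (fun y : E => ‖y - c‖ ^ 2) := (contDiff_id.sub contDiff_const).norm_sq ℝ
  rw [hd.contDiffAt.laplacian_eq_sum]
  simp_rw [fderiv_norm_sub_sq_apply]
  have h (e : E) : fderiv ℝ (fun y : E => 2 * inner ℝ (y - c) e) x e = 2 * ‖e‖ ^ 2 := by
    have h1 : HasFDerivAt (fun y : E => 2 * inner ℝ (y - c) e) ((2 : ℝ) • innerSL ℝ e) x := by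
      have := (((innerSL ℝ e).hasFDerivAt (x := x)).sub_const (inner ℝ e c)).const_mul 2
      refine this.congr_of_eventuallyEq (Filter.Eventually.of_forall fun y => ?_)
      simp [inner_sub_left, real_inner_comm]
    rw [h1.fderiv]
    simp
  simp_rw [h]
  simp [mul_comm]

theorem laplacian_exp_inner (a x : E) :
    Laplacian.laplacian (fun y : E => Real.exp (inner ℝ a y)) x
      = ‖a‖ ^ 2 * Real.exp (inner ℝ a x) := by
  have hd : ContDiff ℝ 2 (fun y : E => Real.exp (inner ℝ a y)) :=
    Real.contDiff_exp.comp (contDiff_const.inner ℝ contDiff_id)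
  have h1 (y : E) : HasFDerivAt (fun y : E => Real.exp (inner ℝ a y))
      (Real.exp (inner ℝ a y) • innerSL ℝ a) y :=
    ((innerSL ℝ a).hasFDerivAt (x := y)).exp
  have h2 (y e : E) : fderiv ℝ (fun y : E => Real.exp (inner ℝ a y)) y e
      = Real.exp (inner ℝ a y) * inner ℝ a e := by
    rw [(h1 y).fderiv]
    simp
  rw [hd.contDiffAt.laplacian_eq_sum]
  simp_rw [h2]
  have h3 (e : E) : fderiv ℝ (fun y : E => Real.exp (inner ℝ a y) * inner ℝ a e) x e
      = ‖inner ℝ e a‖ ^ 2 * Real.exp (inner ℝ a x) := by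
    rw [((h1 x).mul_const (inner ℝ a e)).fderiv, real_inner_comm a e]
    simp
    ring
  simp_rw [h3]
  rw [← Finset.sum_mul, OrthonormalBasis.sum_sq_norm_inner_right]

end Calculus

section Green

open MeasureTheory Module Metric

variable {E : Type*} [NormedAddCommGroup E] [InnerProductSpace ℝ E] [FiniteDimensional ℝ E]
  [MeasurableSpace E] [BorelSpace E]

theorem ContinuousOn.integrable_mul_of_tsupport_subset {a b : E → ℝ} {s : Set E}
    (ha : ContinuousOn a s) (hs : IsOpen s) (hb : Continuous b) (hbc : HasCompactSupport b)
    (hbs : tsupport b ⊆ s) : Integrable (fun x => a x * b x) (volume : Measure E) :=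
  ((ha.mul hb.continuousOn).continuous_of_tsupport_subset hs
    ((tsupport_mul_subset_right).trans hbs)).integrable_of_hasCompactSupport hbc.mul_left

theorem integral_mul_fderiv_eq_neg_of_contDiffOn {a b : E → ℝ} {s : Set E}
    (ha : ContDiffOn ℝ 1 a s) (hs : IsOpen s) (hb : ContDiff ℝ 1 b) (hbc : HasCompactSupport b)
    (hbs : tsupport b ⊆ s) (e : E) :
    ∫ x, a x * fderiv ℝ b x e = -∫ x, fderiv ℝ a x e * b x := by
  have ha' : ContinuousOn (fun x => fderiv ℝ a x e) s :=
    (ha.fderiv_apply_of_isOpen hs (m := 0) (by norm_num) e).continuousOn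
  have hb' : Continuous fun x => fderiv ℝ b x e :=
    (hb.continuous_fderiv one_ne_zero).clm_apply continuous_const
  refine integral_mul_fderiv_eq_neg_fderiv_mul_of_integrable
    (ha'.integrable_mul_of_tsupport_subset hs hb.continuous hbc hbs)
    (ha.continuousOn.integrable_mul_of_tsupport_subset hs hb' (hbc.fderiv_apply ℝ e)
      ((tsupport_fderiv_apply_subset ℝ e).trans hbs))
    (ha.continuousOn.integrable_mul_of_tsupport_subset hs hb.continuous hbc hbs)
    (fun x hx => (ha.differentiableOn one_ne_zero).differentiableAt (hs.mem_nhds (hbs hx)))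
    (fun x _ => hb.differentiable one_ne_zero x)

/-- Green's second identity for a compactly supported factor. -/
theorem integral_mul_laplacian_eq {a b : E → ℝ} {s : Set E}
    (ha : ContDiffOn ℝ 2 a s) (hs : IsOpen s) (hb : ContDiff ℝ 2 b) (hbc : HasCompactSupport b)
    (hbs : tsupport b ⊆ s) :
    ∫ x, a x * Laplacian.laplacian b x = ∫ x, Laplacian.laplacian a x * b x := by
  set v := stdOrthonormalBasis ℝ E
  have ha1 (i) : ContDiffOn ℝ 1 (fun x => fderiv ℝ a x (v i)) s :=
    ha.fderiv_apply_of_isOpen hs (by norm_num) _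
  have hb1 (i) : ContDiff ℝ 1 (fun x => fderiv ℝ b x (v i)) :=
    (hb.fderiv_right (by norm_num)).clm_apply contDiff_const
  have hc1 (i) := hbc.fderiv_apply ℝ (v i)
  have hs1 (i) := (tsupport_fderiv_apply_subset ℝ (f := b) (v i)).trans hbs
  have key (i) : ∫ x, a x * fderiv ℝ (fun y => fderiv ℝ b y (v i)) x (v i) =
      ∫ x, fderiv ℝ (fun y => fderiv ℝ a y (v i)) x (v i) * b x := by
    rw [integral_mul_fderiv_eq_neg_of_contDiffOn (ha.of_le (by norm_num)) hs (hb1 i) (hc1 i)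
      (hs1 i), integral_mul_fderiv_eq_neg_of_contDiffOn (ha1 i) hs (hb.of_le (by norm_num)) hbc
      hbs, neg_neg]
  have hL : ∫ x, a x * Laplacian.laplacian b x =
      ∑ i, ∫ x, a x * fderiv ℝ (fun y => fderiv ℝ b y (v i)) x (v i) := by
    rw [← integral_finsetSum]
    · simp_rw [hb.contDiffAt.laplacian_eq_sum, Finset.mul_sum]; rfl
    · intro i _
      exact ha.continuousOn.integrable_mul_of_tsupport_subset hs
        (((hb1 i).continuous_fderiv one_ne_zero).clm_apply continuous_const)
        ((hc1 i).fderiv_apply ℝ _) ((tsupport_fderiv_apply_subset ℝ _).trans (hs1 i))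
  have hR : ∫ x, Laplacian.laplacian a x * b x =
      ∑ i, ∫ x, fderiv ℝ (fun y => fderiv ℝ a y (v i)) x (v i) * b x := by
    rw [← integral_finsetSum]
    · refine integral_congr_ae (Filter.Eventually.of_forall fun x => ?_)
      by_cases hx : x ∈ s
      · simp only [(ha.contDiffAt (hs.mem_nhds hx)).laplacian_eq_sum, Finset.sum_mul]; rfl
      · simp [image_eq_zero_of_notMem_tsupport fun h => hx (hbs h)]
    · intro i _
      exact ((ha1 i).fderiv_apply_of_isOpen hs (m := 0)
        (by norm_num) _).continuousOn.integrable_mul_of_tsupport_subset hs hb.continuous hbc hbs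
  rw [hL, hR]
  exact Finset.sum_congr rfl fun i _ => key i

end Green

section Mollification

open MeasureTheory Module Metric

variable {E : Type*} [NormedAddCommGroup E] [InnerProductSpace ℝ E] [FiniteDimensional ℝ E]
  [MeasurableSpace E] [BorelSpace E]

open scoped Convolution ContDiff

theorem fderiv_convolution_mul_apply {u ρ : E → ℝ} (hu : Continuous u)
    (hρ : ContDiff ℝ 1 ρ) (hc : HasCompactSupport ρ) (x e : E) :
    fderiv ℝ (u ⋆[ContinuousLinearMap.mul ℝ ℝ, volume] ρ) x e =
      (u ⋆[ContinuousLinearMap.mul ℝ ℝ, volume] fun y => fderiv ℝ ρ y e) x := by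
  rw [(hc.hasFDerivAt_convolution_right _ hu.locallyIntegrable hρ x).fderiv,
    convolution_precompR_apply _ hu.locallyIntegrable (hc.fderiv ℝ)
      (hρ.continuous_fderiv one_ne_zero)]

theorem laplacian_convolution_mul {u ρ : E → ℝ} (hu : Continuous u)
    (hρ : ContDiff ℝ 2 ρ) (hc : HasCompactSupport ρ) (x : E) :
    Laplacian.laplacian (u ⋆[ContinuousLinearMap.mul ℝ ℝ, volume] ρ) x =
      ∫ t, u t * Laplacian.laplacian ρ (x - t) := by
  set v := stdOrthonormalBasis ℝ E
  have hW : ContDiff ℝ (2 : ℕ∞) (u ⋆[ContinuousLinearMap.mul ℝ ℝ, volume] ρ) :=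
    hc.contDiff_convolution_right _ hu.locallyIntegrable hρ
  have hρ1 (i) : ContDiff ℝ 1 (fun x => fderiv ℝ ρ x (v i)) :=
    (hρ.fderiv_right (by norm_num)).clm_apply contDiff_const
  have hc1 (i) := hc.fderiv_apply ℝ (v i)
  rw [ContDiffAt.laplacian_eq_sum (u := u ⋆[ContinuousLinearMap.mul ℝ ℝ, volume] ρ)
    hW.contDiffAt]
  simp_rw [fderiv_convolution_mul_apply hu (hρ.of_le (by norm_num)) hc,
    hρ.contDiffAt.laplacian_eq_sum, Finset.mul_sum]
  rw [integral_finsetSum]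
  · refine Finset.sum_congr rfl fun i _ => ?_
    have := fderiv_convolution_mul_apply hu (hρ1 i) (hc1 i) x (v i)
    rw [convolution_def] at this
    exact this
  · intro i _
    have hcont : Continuous fun t => fderiv ℝ (fun y => fderiv ℝ ρ y (v i)) t (v i) :=
      ((hρ1 i).continuous_fderiv one_ne_zero).clm_apply continuous_const
    exact (hu.mul (hcont.comp (continuous_const.sub continuous_id))).integrable_of_hasCompactSupport
      (((hc1 i).fderiv_apply ℝ (v i)).comp_homeomorph (Homeomorph.subLeft x)).mul_left

/-- If `Δ u = f` in the sense of distributions on `Ω` and `u + q` has a local maximum at a point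
of `Ω`, then `f + Δ q ≤ 0` at this point. -/
theorem add_laplacian_nonpos_of_isLocalMax {Ω : TopologicalSpace.Opens E} {u f q : E → ℝ}
    (hu : Continuous u) (hf : Continuous f)
    (huf : ∀ φ : 𝓓(Ω, ℝ), ∫ x, u x * Laplacian.laplacian (φ : E → ℝ) x = ∫ x, f x * φ x)
    (hq : ContDiff ℝ 2 q) {x₀ : E} (hx₀ : x₀ ∈ Ω) (hmax : IsLocalMax (u + q) x₀) :
    f x₀ + Laplacian.laplacian q x₀ ≤ 0 := by
  by_contra! hpos
  set ε := f x₀ + Laplacian.laplacian q x₀ with hε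
  have hΔq : Continuous (Laplacian.laplacian q) :=
    continuousOn_univ.1 (hq.contDiffOn.continuousOn_laplacian isOpen_univ)
  set n : ℝ := (finrank ℝ E : ℝ) with hn
  have hn0 : 0 ≤ n := Nat.cast_nonneg _
  set η : ℝ := ε / (8 * (n + 1)) with hη
  have hη0 : 0 < η := by positivity
  have hηn : 2 * n * η ≤ ε / 4 := by
    rw [hη, ← mul_div_assoc, div_le_div_iff₀ (by positivity) (by norm_num)]
    nlinarith
  set q₂ : E → ℝ := q - η • fun y => ‖y - x₀‖ ^ 2 with hq₂
  have hN : ContDiff ℝ 2 (fun y : E => ‖y - x₀‖ ^ 2) := (contDiff_id.sub contDiff_const).norm_sq ℝ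
  have hN' : ContDiff ℝ 2 (η • fun y : E => ‖y - x₀‖ ^ 2) := hN.const_smul η
  have hq₂c : ContDiff ℝ 2 q₂ := hq.sub hN'
  have hΔq₂ (x : E) : Laplacian.laplacian q₂ x = Laplacian.laplacian q x - 2 * n * η := by
    rw [hq₂, ContDiffAt.laplacian_sub hq.contDiffAt hN'.contDiffAt,
      InnerProductSpace.laplacian_smul η hN.contDiffAt, laplacian_norm_sub_sq, smul_eq_mul]
    ring
  obtain ⟨R, hR0, hR⟩ : ∃ R > 0, ∀ x ∈ ball x₀ R, x ∈ Ω ∧ (u + q) x ≤ (u + q) x₀ ∧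
      f x₀ - ε / 4 < f x ∧ Laplacian.laplacian q x₀ - ε / 4 < Laplacian.laplacian q x := by
    refine Metric.eventually_nhds_iff_ball.1 ?_
    filter_upwards [Ω.isOpen.mem_nhds hx₀, hmax,
      hf.continuousAt.eventually (lt_mem_nhds (show f x₀ - ε / 4 < f x₀ by linarith)),
      hΔq.continuousAt.eventually (lt_mem_nhds
        (show Laplacian.laplacian q x₀ - ε / 4 < Laplacian.laplacian q x₀ by linarith))]
      with x h1 h2 h3 h4 using ⟨h1, h2, h3, h4⟩
  set s := R / 2 with hs
  have hs0 : 0 < s := by positivity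
  set τ := η * s ^ 2 / 4 with hτ
  have hτ0 : 0 < τ := by positivity
  obtain ⟨δ, hδ0, hδ⟩ := Metric.uniformContinuousOn_iff.1
    ((isCompact_closedBall x₀ R).uniformContinuousOn_of_continuous hu.continuousOn) τ hτ0
  set δ' := min δ (s / 2) with hδ'
  have hδ'0 : 0 < δ' := lt_min hδ0 (half_pos hs0)
  let B : ContDiffBump (0 : E) := ⟨δ' / 2, δ', by positivity, by linarith⟩
  set ρ : E → ℝ := B.normed volume with hρ
  have hρc : HasCompactSupport ρ := B.hasCompactSupport_normed
  have hρs : ContDiff ℝ (⊤ : ℕ∞) ρ := B.contDiff_normed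
  have hρ2 : ContDiff ℝ 2 ρ := B.contDiff_normed (n := 2)
  have hshift {x y : E} (hx : x ∈ closedBall x₀ s) (hy : dist y x < s) : y ∈ ball x₀ R := by
    rw [mem_ball]
    linarith [dist_triangle y x x₀, mem_closedBall.1 hx]
  set W := u ⋆[ContinuousLinearMap.mul ℝ ℝ, volume] ρ with hW
  have hWc : ContDiff ℝ 2 W :=
    hρc.contDiff_convolution_right (n := 2) _ hu.locallyIntegrable hρ2
  have hWu {x : E} (hx : x ∈ closedBall x₀ s) : |W x - u x| ≤ τ := by
    have h1 : W x = (ρ ⋆[ContinuousLinearMap.lsmul ℝ ℝ, volume] u) x := by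
      rw [hW, convolution_lsmul_swap, convolution_def]
      simp [mul_comm]
    rw [h1, ← Real.dist_eq]
    refine B.dist_normed_convolution_le hu.aestronglyMeasurable fun y hy => ?_
    have hy' : dist y x < min δ (s / 2) := hy
    refine (hδ y ?_ x ?_ (hy'.trans_le (min_le_left _ _))).le
    · exact ball_subset_closedBall (hshift hx (hy'.trans_le
        ((min_le_right _ _).trans (half_le_self hs0.le))))
    · exact closedBall_subset_closedBall (by linarith) hx
  have hWΔ {x : E} (hx : x ∈ closedBall x₀ s) : f x₀ - ε / 4 ≤ Laplacian.laplacian W x := by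
    have hsupp : tsupport (fun t => ρ (x - t)) ⊆ closedBall x δ' := by
      refine closure_minimal (fun t ht => ?_) isClosed_closedBall
      have : x - t ∈ Function.support ρ := ht
      rw [hρ, B.support_normed_eq, mem_ball_zero_iff] at this
      rw [mem_closedBall, dist_eq_norm, norm_sub_rev]
      exact this.le
    have hball {t : E} (ht : t ∈ closedBall x δ') : t ∈ ball x₀ R :=
      hshift hx ((mem_closedBall.1 ht).trans_lt ((min_le_right _ _).trans_lt (half_lt_self hs0)))
    have hφc : HasCompactSupport fun t => ρ (x - t) :=
      hρc.comp_homeomorph (Homeomorph.subLeft x)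
    let φ : 𝓓(Ω, ℝ) := ⟨fun t => ρ (x - t), hρs.comp (contDiff_const.sub contDiff_id), hφc,
      fun t ht => (hR t (hball (hsupp ht))).1⟩
    have hφcont : Continuous fun t => ρ (x - t) := φ.contDiff.continuous
    have hφ1 : ∫ t, ρ (x - t) = 1 := by
      rw [integral_sub_left_eq_self ρ volume x, hρ, B.integral_normed]
    calc f x₀ - ε / 4 = ∫ t, (f x₀ - ε / 4) * ρ (x - t) := by
          rw [integral_const_mul, hφ1, mul_one]
      _ ≤ ∫ t, f t * ρ (x - t) := by
          refine integral_mono ((continuous_const.mul hφcont).integrable_of_hasCompactSupport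
            hφc.mul_left) ((hf.mul hφcont).integrable_of_hasCompactSupport hφc.mul_left)
            fun t => ?_
          by_cases ht : t ∈ tsupport fun t => ρ (x - t)
          · exact mul_le_mul_of_nonneg_right (hR t (hball (hsupp ht))).2.2.1.le (B.nonneg_normed _)
          · simp [image_eq_zero_of_notMem_tsupport ht]
      _ = Laplacian.laplacian W x := by
          rw [hW, laplacian_convolution_mul hu hρ2 hρc]
          simp_rw [← laplacian_const_sub_comp hρ2]
          exact (huf φ).symm
  obtain ⟨x₁, hx₁, hx₁max⟩ := (isCompact_closedBall x₀ s).exists_isMaxOn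
    (nonempty_closedBall.2 hs0.le) (hWc.add hq₂c).continuous.continuousOn
  have hq₂x (x : E) : q₂ x = q x - η * ‖x - x₀‖ ^ 2 := rfl
  have hlt : x₁ ∈ ball x₀ s := by
    by_contra hnot
    have hdist : ‖x₁ - x₀‖ = s := by
      rw [← dist_eq_norm]
      exact le_antisymm hx₁ (not_lt.1 hnot)
    have h1 : W x₀ + q₂ x₀ ≤ W x₁ + q₂ x₁ := hx₁max (mem_closedBall_self hs0.le)
    have h2 := abs_le.1 (hWu hx₁)
    have h3 := abs_le.1 (hWu (mem_closedBall_self hs0.le))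
    have h4 : u x₁ + q x₁ ≤ u x₀ + q x₀ := (hR x₁ (by rw [mem_ball, dist_eq_norm]; linarith)).2.1
    rw [hq₂x, hq₂x, hdist] at h1
    simp only [sub_self, norm_zero] at h1
    linarith
  have hloc : IsLocalMax (W + q₂) x₁ := by
    filter_upwards [isOpen_ball.mem_nhds hlt] with x hx using hx₁max (ball_subset_closedBall hx)
  have h1 := hloc.laplacian_nonpos (hWc.add hq₂c).contDiffAt
  rw [ContDiffAt.laplacian_add hWc.contDiffAt hq₂c.contDiffAt, hΔq₂] at h1
  have h2 := hWΔ hx₁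
  have h3 := (hR x₁ (by rw [mem_ball] at hlt ⊢; linarith)).2.2.2
  linarith

end Mollification

section Relation

variable {X : Type*} [NormedAddCommGroup X] [NormedSpace ℝ X] {A : LinearRelation X}

namespace LinearRelation

theorem mem_scalarSub_iff {l : ℝ} {x y : X} :
    (x, y) ∈ scalarSub l A ↔ (x, l • x - y) ∈ A := by
  rw [mem_scalarSub]
  constructor
  · rintro ⟨x', y', h, he⟩
    obtain ⟨rfl, rfl⟩ := Prod.mk.inj he
    simpa using h
  · exact fun h => ⟨x, _, h, by simp⟩

theorem isClosed_scalarSub (hA : IsClosed (A : Set (X × X))) (l : ℝ) :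
    IsClosed (scalarSub l A : Set (X × X)) := by
  have h : (scalarSub l A : Set (X × X)) =
      (fun p : X × X => (p.1, l • p.1 - p.2)) ⁻¹' (A : Set (X × X)) := by
    ext ⟨x, y⟩
    exact mem_scalarSub_iff
  rw [h]
  exact hA.preimage (by fun_prop)

/-- The range of a closed relation whose inverse is bounded is closed. -/
theorem isClosed_ran [CompleteSpace X] (hA : IsClosed (A : Set (X × X))) {C : ℝ}
    (hC : ∀ x y, (x, y) ∈ A → ‖x‖ ≤ C * ‖y‖) : IsClosed (A.ran : Set X) := by
  have : CompleteSpace A := hA.completeSpace_coe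
  let T : A →ₗ[ℝ] X := (LinearMap.snd ℝ X X).comp A.subtype
  have hT : AntilipschitzWith (max C 1).toNNReal T := by
    refine AddMonoidHomClass.antilipschitz_of_bound T fun p => ?_
    rw [Real.coe_toNNReal _ (zero_le_one.trans (le_max_right _ _))]
    change max ‖p.1.1‖ ‖p.1.2‖ ≤ max C 1 * ‖p.1.2‖
    refine max_le ((hC _ _ p.2).trans ?_) ?_
    · exact mul_le_mul_of_nonneg_right (le_max_left _ _) (norm_nonneg _)
    · exact le_mul_of_one_le_left (norm_nonneg _) (le_max_right _ _)
  have hcont : LipschitzWith 1 T := LipschitzWith.prod_snd.comp (LipschitzWith.subtype_val _)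
    |>.weaken (by simp)
  have hr : (A.ran : Set X) = Set.range T := by
    ext y
    simp only [SetLike.mem_coe, mem_ran, Set.mem_range]
    exact ⟨fun ⟨x, hx⟩ => ⟨⟨(x, y), hx⟩, rfl⟩, fun ⟨p, hp⟩ => ⟨p.1.1, hp ▸ p.2⟩⟩
  rw [hr]
  exact hT.isClosed_range hcont.uniformContinuous

/-- A surjective relation with bounded inverse stays surjective under small perturbations. -/
theorem ran_scalarSub_eq_top [CompleteSpace X] (hran : A.ran = ⊤) {C l : ℝ}
    (hC : ∀ x y, (x, y) ∈ A → ‖x‖ ≤ C * ‖y‖) (hl : 0 ≤ l) (hlC : l * C < 1) :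
    (scalarSub l A).ran = ⊤ := by
  have hex (y : X) : ∃ x, (x, y) ∈ A := mem_ran.1 (hran ▸ Submodule.mem_top)
  choose T hT using hex
  rw [eq_top_iff]
  intro g _
  have hcontr : ContractingWith (l * C).toNNReal fun y => l • T y - g := by
    refine ⟨?_, LipschitzWith.of_dist_le_mul fun y z => ?_⟩
    · rw [← Real.toNNReal_one]
      exact (Real.toNNReal_lt_toNNReal_iff one_pos).2 hlC
    · rw [dist_eq_norm, dist_eq_norm, sub_sub_sub_cancel_right, ← smul_sub, norm_smul,
        Real.norm_of_nonneg hl]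
      calc l * ‖T y - T z‖ ≤ l * (C * ‖y - z‖) :=
            mul_le_mul_of_nonneg_left (hC _ _ (A.sub_mem (hT y) (hT z))) hl
        _ = l * C * ‖y - z‖ := by ring
        _ ≤ _ := mul_le_mul_of_nonneg_right (Real.le_coe_toNNReal _) (norm_nonneg _)
  have hfix := hcontr.fixedPoint_isFixedPt
  set y := ContractingWith.fixedPoint _ hcontr
  refine mem_ran.2 ⟨T y, mem_scalarSub_iff.2 ?_⟩
  have : l • T y - g = y := hfix
  rw [this]
  exact hT y

end LinearRelation

end Relation

section Exponentials

variable {E : Type*} [NormedAddCommGroup E] [InnerProductSpace ℝ E]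

/-- The function `x ↦ exp ⟪a, x⟫` on a subset. -/
noncomputable def expInner (K : Set E) (a : E) : C(K, ℝ) where
  toFun x := Real.exp (inner ℝ a (x : E))
  continuous_toFun := by fun_prop

/-- The functions `x ↦ exp ⟪a, x⟫` as a monoid homomorphism. -/
noncomputable def expInnerHom (K : Set E) : Multiplicative E →* C(K, ℝ) where
  toFun a := expInner K a.toAdd
  map_one' := by ext x; simp [expInner]
  map_mul' a b := by ext x; simp [expInner, inner_add_left, Real.exp_add]

theorem eq_top_of_isClosed_of_expInner_mem {K : Set E} [CompactSpace K]
    {V : Submodule ℝ C(K, ℝ)} (hV : IsClosed (V : Set C(K, ℝ))) (h : ∀ a, expInner K a ∈ V) :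
    V = ⊤ := by
  set S : Subalgebra ℝ C(K, ℝ) :=
    Algebra.adjoin ℝ (MonoidHom.mrange (expInnerHom K) : Set C(K, ℝ)) with hS
  have hSV : (S : Set C(K, ℝ)) ⊆ V := by
    have hle : Subalgebra.toSubmodule S ≤ V := by
      rw [hS, Algebra.adjoin_eq_span, Submonoid.closure_eq, Submodule.span_le]
      rintro _ ⟨a, rfl⟩
      exact h a.toAdd
    exact hle
  have hsep : S.SeparatesPoints := by
    intro x y hxy
    refine ⟨_, ⟨expInner K (x - y : E), Algebra.subset_adjoin
      ⟨Multiplicative.ofAdd (x - y : E), rfl⟩, rfl⟩, fun heq => hxy ?_⟩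
    have h1 : inner ℝ (x - y : E) (x : E) = inner ℝ (x - y : E) (y : E) := Real.exp_injective heq
    rw [← sub_eq_zero, ← inner_sub_right, inner_self_eq_zero, sub_eq_zero] at h1
    exact Subtype.ext h1
  have htop := ContinuousMap.subalgebra_topologicalClosure_eq_top_of_separatesPoints S hsep
  rw [eq_top_iff]
  intro f _
  have hf : f ∈ S.topologicalClosure := htop ▸ Algebra.mem_top
  exact closure_minimal hSV hV hf

end Exponentials

section DirichletLaplacian

open MeasureTheory Metric

variable {d : ℕ} {c : EuclideanSpace ℝ (Fin d)} {r : ℝ}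
  {Ω : TopologicalSpace.Opens (EuclideanSpace ℝ (Fin d))}

theorem integral_ballVolume {g : EuclideanSpace ℝ (Fin d) → ℝ}
    (hg : ∀ x ∉ closedBall c r, g x = 0) :
    ∫ x : closedBall c r, g x ∂(ballVolume c r) = ∫ x, g x := by
  rw [ballVolume, integral_subtype_comap isClosed_closedBall.measurableSet,
    setIntegral_eq_integral_of_forall_compl_eq_zero hg]

theorem TestFunction.laplacian_eq_zero_of_notMem (φ : 𝓓(Ω, ℝ)) {x : EuclideanSpace ℝ (Fin d)}
    (hx : x ∉ Ω) : Laplacian.laplacian (φ : EuclideanSpace ℝ (Fin d) → ℝ) x = 0 := by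
  have h : (φ : EuclideanSpace ℝ (Fin d) → ℝ) =ᶠ[nhds x] fun _ => 0 :=
    notMem_tsupport_iff_eventuallyEq.1 fun h => hx (φ.tsupport_subset h)
  rw [(InnerProductSpace.laplacian_congr_nhds h).eq_of_nhds]
  simp

theorem TestFunction.eq_zero_of_notMem (φ : 𝓓(Ω, ℝ)) {x : EuclideanSpace ℝ (Fin d)}
    (hx : x ∉ Ω) : φ x = 0 :=
  image_eq_zero_of_notMem_tsupport fun h => hx (φ.tsupport_subset h)

theorem mem_dirichletLaplacian {u f : C(closedBall c r, ℝ)} :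
    (u, f) ∈ dirichletLaplacian c r Ω ↔
      (∀ x : closedBall c r, (x : EuclideanSpace ℝ (Fin d)) ∉ Ω → u x = 0) ∧
      ∀ φ : 𝓓(Ω, ℝ), ∫ x : closedBall c r,
          u x * Laplacian.laplacian (φ : EuclideanSpace ℝ (Fin d) → ℝ) x ∂(ballVolume c r) =
        ∫ x : closedBall c r, f x * φ x ∂(ballVolume c r) :=
  Iff.rfl

/-- Membership in the Dirichlet Laplacian in terms of functions on the whole space. -/
theorem mem_dirichletLaplacian_of_eq (hΩ : (Ω : Set (EuclideanSpace ℝ (Fin d))) ⊆ ball c r)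
    {u f : C(closedBall c r, ℝ)} {u' f' : EuclideanSpace ℝ (Fin d) → ℝ}
    (hu : ∀ x, u x = u' x) (hf : ∀ x, f x = f' x) :
    (u, f) ∈ dirichletLaplacian c r Ω ↔
      (∀ x : closedBall c r, (x : EuclideanSpace ℝ (Fin d)) ∉ Ω → u x = 0) ∧
      ∀ φ : 𝓓(Ω, ℝ), ∫ x, u' x * Laplacian.laplacian (φ : EuclideanSpace ℝ (Fin d) → ℝ) x =
        ∫ x, f' x * φ x := by
  have hout {x} (hx : x ∉ closedBall c r) : x ∉ Ω := fun h => hx (ball_subset_closedBall (hΩ h))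
  rw [mem_dirichletLaplacian]
  refine and_congr_right fun _ => forall_congr' fun φ => ?_
  simp_rw [hu, hf]
  rw [integral_ballVolume (g := fun x => u' x *
      Laplacian.laplacian (φ : EuclideanSpace ℝ (Fin d) → ℝ) x)
      fun x hx => by rw [φ.laplacian_eq_zero_of_notMem (hout hx), mul_zero],
    integral_ballVolume (g := fun x => f' x * φ x)
      fun x hx => by rw [φ.eq_zero_of_notMem (hout hx), mul_zero]]

/-- The maximum principle for the Dirichlet Laplacian. -/
theorem add_laplacian_nonpos_of_mem_dirichletLaplacian
    (hΩ : (Ω : Set (EuclideanSpace ℝ (Fin d))) ⊆ ball c r)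
    {u f : C(closedBall c r, ℝ)} (huf : (u, f) ∈ dirichletLaplacian c r Ω)
    {q : EuclideanSpace ℝ (Fin d) → ℝ} (hq : ContDiff ℝ 2 q) {x₀ : closedBall c r}
    (hx₀ : (x₀ : EuclideanSpace ℝ (Fin d)) ∈ Ω) (hmax : ∀ x, u x + q x ≤ u x₀ + q x₀) :
    f x₀ + Laplacian.laplacian q x₀ ≤ 0 := by
  obtain ⟨u', rfl⟩ := ContinuousMap.exists_restrict_eq isClosed_closedBall u
  obtain ⟨f', rfl⟩ := ContinuousMap.exists_restrict_eq isClosed_closedBall f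
  have h := ((mem_dirichletLaplacian_of_eq hΩ (fun _ => rfl) (fun _ => rfl)).1 huf).2
  refine add_laplacian_nonpos_of_isLocalMax u'.continuous f'.continuous h hq hx₀ ?_
  filter_upwards [Ω.isOpen.mem_nhds hx₀] with x hx
    using hmax ⟨x, ball_subset_closedBall (hΩ hx)⟩

theorem apply_le_sq_mul_norm_of_mem_dirichletLaplacian (hd : 1 ≤ d) (hr : 0 < r)
    (hΩ : (Ω : Set (EuclideanSpace ℝ (Fin d))) ⊆ ball c r)
    {u f : C(closedBall c r, ℝ)} (huf : (u, f) ∈ dirichletLaplacian c r Ω) (x : closedBall c r) :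
    u x ≤ r ^ 2 * ‖f‖ := by
  refine le_of_forall_pos_le_add fun δ hδ => ?_
  set κ := ‖f‖ + δ / r ^ 2 with hκ
  have hκ0 : 0 < κ := by positivity
  have hκr : κ * r ^ 2 = r ^ 2 * ‖f‖ + δ := by rw [hκ]; field_simp
  set q : EuclideanSpace ℝ (Fin d) → ℝ := κ • fun y => ‖y - c‖ ^ 2 with hq
  have hN : ContDiff ℝ 2 (fun y : EuclideanSpace ℝ (Fin d) => ‖y - c‖ ^ 2) :=
    (contDiff_id.sub contDiff_const).norm_sq ℝ
  have hqc : ContDiff ℝ 2 q := hN.const_smul κ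
  have hqx (y) : q y = κ * ‖y - c‖ ^ 2 := rfl
  have hq0 (y) : 0 ≤ q y := by rw [hqx]; positivity
  have hqle (y : closedBall c r) : q y ≤ κ * r ^ 2 := by
    have : ‖(y : EuclideanSpace ℝ (Fin d)) - c‖ ≤ r := by
      rw [← dist_eq_norm]; exact y.2
    rw [hqx]
    gcongr
  obtain ⟨x₁, -, hx₁⟩ := isCompact_univ.exists_isMaxOn ⟨x, Set.mem_univ x⟩
    (u.continuous.add (hqc.continuous.comp continuous_subtype_val)).continuousOn
  have hmax (y : closedBall c r) : u y + q y ≤ u x₁ + q x₁ := hx₁ (Set.mem_univ y)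
  rw [← hκr]
  by_cases hx₁Ω : (x₁ : EuclideanSpace ℝ (Fin d)) ∈ Ω
  · have h1 := add_laplacian_nonpos_of_mem_dirichletLaplacian hΩ huf hqc hx₁Ω hmax
    rw [hq, InnerProductSpace.laplacian_smul κ hN.contDiffAt, laplacian_norm_sub_sq,
      finrank_euclideanSpace_fin, smul_eq_mul] at h1
    have h2 : -‖f‖ ≤ f x₁ := (abs_le.1 (f.norm_coe_le_norm x₁)).1
    have h3 : (1 : ℝ) ≤ d := by exact_mod_cast hd
    have h4 : ‖f‖ < κ := by rw [hκ]; linarith [show 0 < δ / r ^ 2 by positivity]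
    nlinarith
  · have h1 := huf.1 x₁ hx₁Ω
    change u x₁ = 0 at h1
    linarith [hmax x, hq0 x, hqle x₁]

theorem norm_le_of_mem_dirichletLaplacian (hd : 1 ≤ d) (hr : 0 < r)
    (hΩ : (Ω : Set (EuclideanSpace ℝ (Fin d))) ⊆ ball c r)
    (u f : C(closedBall c r, ℝ)) (huf : (u, f) ∈ dirichletLaplacian c r Ω) :
    ‖u‖ ≤ r ^ 2 * ‖f‖ := by
  refine (ContinuousMap.norm_le _ (by positivity)).2 fun x => abs_le.2 ⟨?_, ?_⟩
  · have := apply_le_sq_mul_norm_of_mem_dirichletLaplacian hd hr hΩ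
      ((dirichletLaplacian c r Ω).neg_mem huf) x
    rw [norm_neg] at this
    exact neg_le.1 this
  · exact apply_le_sq_mul_norm_of_mem_dirichletLaplacian hd hr hΩ huf x

theorem isDissipative_dirichletLaplacian
    (hΩ : (Ω : Set (EuclideanSpace ℝ (Fin d))) ⊆ ball c r) :
    (dirichletLaplacian c r Ω).IsDissipative := by
  intro u f huf l hl
  have key (u f : C(closedBall c r, ℝ)) (huf : (u, f) ∈ dirichletLaplacian c r Ω)
      (x : closedBall c r) : l * u x ≤ ‖l • u - f‖ := by
    obtain ⟨x₁, -, hx₁⟩ := isCompact_univ.exists_isMaxOn ⟨x, Set.mem_univ x⟩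
      u.continuous.continuousOn
    have hmax (y : closedBall c r) : u y ≤ u x₁ := hx₁ (Set.mem_univ y)
    refine (mul_le_mul_of_nonneg_left (hmax x) hl.le).trans ?_
    by_cases hx₁Ω : (x₁ : EuclideanSpace ℝ (Fin d)) ∈ Ω
    · have h1 := add_laplacian_nonpos_of_mem_dirichletLaplacian hΩ huf
        (q := fun _ => 0) contDiff_const hx₁Ω (by simpa using hmax)
      have h2 : l * u x₁ - f x₁ ≤ ‖l • u - f‖ :=
        (le_abs_self _).trans ((l • u - f).norm_coe_le_norm x₁)
      simp only [InnerProductSpace.laplacian_const, Pi.zero_apply, add_zero] at h1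
      linarith
    · have h1 := huf.1 x₁ hx₁Ω
      change u x₁ = 0 at h1
      rw [h1, mul_zero]
      exact norm_nonneg _
  refine (ContinuousMap.norm_le _ (norm_nonneg _)).2 fun x => abs_le.2 ⟨?_, key u f huf x⟩
  have h := key (-u) (-f) ((dirichletLaplacian c r Ω).neg_mem huf) x
  rw [show l • -u - -f = -(l • u - f) by rw [smul_neg]; abel, norm_neg] at h
  change l * -u x ≤ _ at h
  change _ ≤ l * u x
  linarith

theorem continuous_integral_mul {ψ : EuclideanSpace ℝ (Fin d) → ℝ} (hψ : Continuous ψ) :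
    Continuous fun u : C(closedBall c r, ℝ) =>
      ∫ x : closedBall c r, u x * ψ x ∂(ballVolume c r) := by
  have h (u : C(closedBall c r, ℝ)) := integrable_mul_continuous u hψ
  let T : C(closedBall c r, ℝ) →ₗ[ℝ] ℝ :=
    { toFun u := ∫ x : closedBall c r, u x * ψ x ∂(ballVolume c r)
      map_add' u v := by
        rw [← integral_add (h u) (h v)]
        simp [add_mul]
      map_smul' a u := by
        simp [mul_assoc, integral_const_mul] }
  have hψi : Integrable (fun x : closedBall c r => ψ x) (ballVolume c r) := by
    simpa using h 1
  refine (T.mkContinuous (∫ x : closedBall c r, ‖ψ x‖ ∂(ballVolume c r)) fun u => ?_).continuous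
  rw [mul_comm, ← integral_const_mul]
  refine norm_integral_le_of_norm_le (hψi.norm.const_mul _) (Filter.Eventually.of_forall fun x => ?_)
  rw [norm_mul]
  exact mul_le_mul_of_nonneg_right (u.norm_coe_le_norm x) (norm_nonneg _)

theorem isClosed_dirichletLaplacian :
    IsClosed (dirichletLaplacian c r Ω : Set (C(closedBall c r, ℝ) × C(closedBall c r, ℝ))) := by
  have h : (dirichletLaplacian c r Ω : Set (C(closedBall c r, ℝ) × C(closedBall c r, ℝ))) =
      {p | ∀ x : closedBall c r, (x : EuclideanSpace ℝ (Fin d)) ∉ Ω → p.1 x = 0} ∩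
      {p | ∀ φ : 𝓓(Ω, ℝ), ∫ x : closedBall c r,
          p.1 x * Laplacian.laplacian (φ : EuclideanSpace ℝ (Fin d) → ℝ) x ∂(ballVolume c r) =
        ∫ x : closedBall c r, p.2 x * φ x ∂(ballVolume c r)} := rfl
  rw [h]
  simp only [Set.ofPred_forall]
  refine IsClosed.inter (isClosed_iInter fun x => isClosed_iInter fun _ => ?_)
    (isClosed_iInter fun φ => ?_)
  · exact isClosed_eq ((continuous_eval_const x).comp continuous_fst)
      continuous_const
  · exact isClosed_eq
      ((continuous_integral_mul (continuous_laplacian_testFunction φ)).comp continuous_fst)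
      ((continuous_integral_mul φ.continuous).comp continuous_snd)

/-- If `Δ v = f` has a classical solution near `Ω`, then `f` lies in the range of the Dirichlet
Laplacian of a Dirichlet regular set. -/
theorem mem_ran_dirichletLaplacian (hΩ : (Ω : Set (EuclideanSpace ℝ (Fin d))) ⊆ ball c r)
    (hreg : DirichletRegular Ω) {v f : EuclideanSpace ℝ (Fin d) → ℝ} (hv : ContDiff ℝ 2 v)
    (hvf : ∀ x ∈ Ω, Laplacian.laplacian v x = f x) {F : C(closedBall c r, ℝ)}
    (hF : ∀ x, F x = f x) : F ∈ (dirichletLaplacian c r Ω).ran := by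
  obtain ⟨h, hh2, hhc, hh0, hhv⟩ := hreg ⟨fun x => v x, hv.continuous.comp continuous_subtype_val⟩
  set w := (Ω : Set (EuclideanSpace ℝ (Fin d))).indicator (v - h) with hw
  have hwc : Continuous w := by
    refine continuous_indicator (fun x hx => ?_) (hv.continuous.continuousOn.sub hhc)
    exact sub_eq_zero.2 (hhv ⟨x, hx⟩).symm
  refine LinearRelation.mem_ran.2 ⟨⟨fun x => w x, hwc.comp continuous_subtype_val⟩,
    (mem_dirichletLaplacian_of_eq hΩ (u' := w) (fun _ => rfl) hF).2
      ⟨fun x hx => Set.indicator_of_notMem hx _, fun φ => ?_⟩⟩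
  calc ∫ x, w x * Laplacian.laplacian (φ : EuclideanSpace ℝ (Fin d) → ℝ) x
      = ∫ x, (v - h) x * Laplacian.laplacian (φ : EuclideanSpace ℝ (Fin d) → ℝ) x := by
        refine integral_congr_ae (Filter.Eventually.of_forall fun x => ?_)
        by_cases hx : x ∈ Ω
        · simp only [hw]
          rw [Set.indicator_of_mem (by exact hx)]
        · simp [φ.laplacian_eq_zero_of_notMem hx]
    _ = ∫ x, Laplacian.laplacian (v - h) x * φ x :=
        integral_mul_laplacian_eq (hv.contDiffOn.sub hh2) Ω.isOpen
          (φ.contDiff.of_le (WithTop.coe_le_coe.2 le_top)) φ.hasCompactSupport φ.tsupport_subset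
    _ = ∫ x, f x * φ x := by
        refine integral_congr_ae (Filter.Eventually.of_forall fun x => ?_)
        by_cases hx : x ∈ Ω
        · have h1 := ContDiffAt.laplacian_sub (hv.contDiffAt (x := x))
            (hh2.contDiffAt (Ω.isOpen.mem_nhds hx))
          rw [hvf x hx, hh0 x hx, sub_zero] at h1
          simp only [h1]
        · simp [φ.eq_zero_of_notMem hx]

theorem ran_dirichletLaplacian (hd : 1 ≤ d) (hr : 0 < r)
    (hΩ : (Ω : Set (EuclideanSpace ℝ (Fin d))) ⊆ ball c r) (hreg : DirichletRegular Ω) :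
    (dirichletLaplacian c r Ω).ran = ⊤ := by
  refine eq_top_of_isClosed_of_expInner_mem (LinearRelation.isClosed_ran
    isClosed_dirichletLaplacian (norm_le_of_mem_dirichletLaplacian hd hr hΩ)) fun a => ?_
  rcases eq_or_ne a 0 with rfl | ha
  · have hN : ContDiff ℝ 2 (fun y : EuclideanSpace ℝ (Fin d) => ‖y - c‖ ^ 2) :=
      (contDiff_id.sub contDiff_const).norm_sq ℝ
    have hd0 : (d : ℝ) ≠ 0 := by positivity
    have hL (x) : Laplacian.laplacian ((2 * d : ℝ)⁻¹ •
        fun y : EuclideanSpace ℝ (Fin d) => ‖y - c‖ ^ 2) x = 1 := by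
      rw [InnerProductSpace.laplacian_smul _ hN.contDiffAt, laplacian_norm_sub_sq,
        finrank_euclideanSpace_fin, smul_eq_mul]
      field_simp
    have hvc : ContDiff ℝ 2 ((2 * d : ℝ)⁻¹ •
        fun y : EuclideanSpace ℝ (Fin d) => ‖y - c‖ ^ 2) := hN.const_smul (2 * d : ℝ)⁻¹
    exact mem_ran_dirichletLaplacian hΩ hreg (f := fun _ => 1) hvc
      (fun x _ => hL x) (fun x => by simp [expInner])
  · have hE : ContDiff ℝ 2 (fun y : EuclideanSpace ℝ (Fin d) => Real.exp (inner ℝ a y)) :=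
      Real.contDiff_exp.comp (contDiff_const.inner ℝ contDiff_id)
    have ha0 : ‖a‖ ≠ 0 := norm_ne_zero_iff.2 ha
    have hL (x) : Laplacian.laplacian ((‖a‖ ^ 2)⁻¹ •
        fun y : EuclideanSpace ℝ (Fin d) => Real.exp (inner ℝ a y)) x
          = Real.exp (inner ℝ a x) := by
      rw [InnerProductSpace.laplacian_smul _ hE.contDiffAt, laplacian_exp_inner, smul_eq_mul]
      field_simp
    have hvc : ContDiff ℝ 2 ((‖a‖ ^ 2)⁻¹ •
        fun y : EuclideanSpace ℝ (Fin d) => Real.exp (inner ℝ a y)) :=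
      hE.const_smul (‖a‖ ^ 2)⁻¹
    exact mem_ran_dirichletLaplacian hΩ hreg hvc (fun x _ => hL x) (fun x => rfl)

end DirichletLaplacian

theorem mainTheorem11 (d : ℕ) (hd : 1 ≤ d) (c : EuclideanSpace ℝ (Fin d)) (r : ℝ) (hr : 0 < r)
    (Ω : TopologicalSpace.Opens (EuclideanSpace ℝ (Fin d)))
    (hΩ : (Ω : Set (EuclideanSpace ℝ (Fin d))) ⊆ Metric.ball c r)
    (hreg : DirichletRegular Ω) :
    (dirichletLaplacian c r Ω).IsMDissipative ∧
      (0 : ℝ) ∈ (dirichletLaplacian c r Ω).resolventSet := by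
  have hC := norm_le_of_mem_dirichletLaplacian hd hr hΩ
  have hran := ran_dirichletLaplacian hd hr hΩ hreg
  refine ⟨⟨isDissipative_dirichletLaplacian hΩ, (2 * r ^ 2)⁻¹, by positivity,
    LinearRelation.ran_scalarSub_eq_top hran hC (by positivity) ?_⟩,
    LinearRelation.isClosed_scalarSub isClosed_dirichletLaplacian 0, ?_, ?_⟩
  · have : (2 * r ^ 2)⁻¹ * r ^ 2 = 1 / 2 := by field_simp
    rw [this]
    norm_num
  · refine (Submodule.eq_bot_iff _).2 fun u hu => ?_
    have h := hC _ _ (LinearRelation.mem_scalarSub_iff.1 (LinearRelation.mem_ker.1 hu))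
    simpa using h
  · exact LinearRelation.ran_scalarSub_eq_top hran hC le_rfl (by simp)
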